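/- Let $\mathfrak g$ be a complex simple Lie algebra with Cartan subalgebra $\mathfrak h$, root set $\Delta$, simple roots $\alpha_1,\dots,\alpha_r$, positive and negative roots $\Delta^{\pm}$, and Weyl group $W$. For $\mathfrak s\subset\mathfrak g$ put $\Delta(\mathfrak s)=\{\alpha\in\Delta : \mathfrak g_\alpha\subset\mathfrak s\}$ and $\Delta^+(\mathfrak s)=\Delta(\mathfrak s)\cap\Delta^+$. Let $Z_1,\dots,Z_r$ be the basis of $\mathfrak h$ dual to the simple roots, and let $\alpha_i$ be a cominuscule simple root, i.e. $\mathfrak g=\mathfrak g_1\oplus\mathfrak g_0\oplus\mathfrak g_{-1}$ with $\mathfrak g_k=\{A\in\mathfrak g : [Z_i,A]=kA\}$; put $\mathfrak p=\mathfrak g_1\oplus\mathfrak g_0$. Let $W_{\mathfrak p}\subset W$ be the Weyl group of $\mathfrak g_0$, let $W^{\mathfrak p}$ be the set of minimal length representatives of the right cosets $W_{\mathfrak p}\backslash W$, and let $w_0$ be the longest element of $W^{\mathfrak p}$. For $w\in W^{\mathfrak p}$ let $\Delta(w)=w\Delta^-\cap\Delta^+\subset\Delta(\mathfrak g_1)$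 be the inversion set of $w$ and put $\mathfrak n_w=\bigoplus_{\alpha\in\Delta(w)}\mathfrak g_{-\alpha}$. Fix $w\in W^{\mathfrak p}\setminus\{1,w_0\}$. Let $J(w)\subset\{1,\dots,r\}\setminus\{i\}$ be the unique subset such that, with $Z_w=\sum_{j\in J(w)}Z_j$ and $\mathfrak g_{k,\ell}=\{A\in\mathfrak g_k : [Z_w,A]=\ell A\}$, the stabilizer of $\mathfrak n_w$ in $\mathfrak g_0$ is $\bigoplus_{\ell\ge0}\mathfrak g_{0,\ell}$; and let $a=a(w)\ge 0$ be the unique integer such that $\Delta(w)=\{\alpha\in\Delta(\mathfrak g_1) : \alpha(Z_w)\le a\}$. Set $$\Pi_{1,a-1}=\{\varepsilon\in\Delta(\mathfrak g_{1,a-1}) : \varepsilon+\alpha\notin\Delta\ \text{ for all }\alpha\in\Delta^+(\mathfrak g_{0,0})\},$$ and, for $\varepsilon\in\Pi_{1,a-1}$, $$\Delta(w,\varepsilon)=\{\varepsilon\}\sqcup\{\nu\in\Delta(\mathfrak g_{1,a}) : \nu-\varepsilon\in\Delta(\mathfrak g_{0,1})\}.$$ Then for every $\varepsilon\in\Pi_{1,a-1}$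 there exists $w_\varepsilon\in W^{\mathfrak p}$ such that $\Delta(w_\varepsilon)=\Delta(w)\setminus\Delta(w,\varepsilon)$. -/

import Mathlib

open LieAlgebra LieAlgebra.IsKilling

noncomputable section

namespace Cominuscule

/- Throughout, `𝔤` is a complex simple Lie algebra, `H` a Cartan subalgebra, `b` a base of the root
system `Δ` of `(𝔤, H)` (equivalently, a choice of Borel subalgebra containing `H`), and
`i : b.support` is the simple root that defines the maximal parabolic subalgebra `𝔭`.
Roots are elements of the index type `H.root`. -/

variable {𝔤 : Type*} [LieRing 𝔤] [LieAlgebra ℂ 𝔤] [FiniteDimensional ℂ 𝔤] [LieAlgebra.IsSimple ℂ 𝔤]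
  {H : LieSubalgebra ℂ 𝔤} [H.IsCartanSubalgebra]

/-- The positive roots `Δ⁺`. -/
def posRoots (b : (rootSystem H).Base) : Set H.root := {α | b.IsPos α}

/-- The negative roots `Δ⁻`. -/
def negRoots (b : (rootSystem H).Base) : Set H.root := {α | b.height α < 0}

/-- `Δ(𝔰)`: the roots whose root space is contained in `𝔰 ⊆ 𝔤`. -/
def rootsIn (H : LieSubalgebra ℂ 𝔤) [H.IsCartanSubalgebra] (s : Set 𝔤) : Set H.root :=
  {α | (rootSpace H (α.1 : H → ℂ) : Set 𝔤) ⊆ s}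

/-- The basis `(Z_j)` of `H` dual to the basis `(α_j)` of simple roots. -/
def gradingElt (b : (rootSystem H).Base) (j : b.support) : H :=
  (Module.evalEquiv ℂ H).symm (b.toWeightBasis.coord j)

/-- The `Z_i`-graded piece `𝔤_k = {A | [Z_i, A] = k A}`. -/
def gr (b : (rootSystem H).Base) (i : b.support) (k : ℤ) : Submodule ℂ 𝔤 :=
  Module.End.eigenspace (LieAlgebra.ad ℂ 𝔤 (gradingElt b i : 𝔤)) (k : ℂ)

/-- The simple root `α_i` is cominuscule: `𝔤 = 𝔤_1 ⊕ 𝔤_0 ⊕ 𝔤_{-1}`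
(the sum is automatically direct, the summands being distinct eigenspaces). -/
def IsCominuscule (b : (rootSystem H).Base) (i : b.support) : Prop :=
  gr b i 1 ⊔ gr b i 0 ⊔ gr b i (-1) = ⊤

/-- The Weyl group `W` of `(𝔤, H)`. -/
abbrev W (H : LieSubalgebra ℂ 𝔤) [H.IsCartanSubalgebra] : Type _ := (rootSystem H).weylGroup

/-- The reflection in the root `α`, as an element of the Weyl group. -/
def refl (α : H.root) : W H := RootPairing.weylGroup.ofIdx (rootSystem H) α

/-- The length of a Weyl group element: the least number of factors in an expression of it as a
product of simple reflections. -/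
def length (b : (rootSystem H).Base) (w : W H) : ℕ :=
  sInf {n | ∃ l : List b.support, l.length = n ∧ (l.map fun j ↦ refl (j : H.root)).prod = w}

/-- `W_𝔭`: the Weyl group of the reductive part `𝔤_0` of `𝔭`, as a subgroup of `W`. -/
def Wp (b : (rootSystem H).Base) (i : b.support) : Subgroup (W H) :=
  Subgroup.closure (refl '' rootsIn H (gr b i 0 : Set 𝔤))

/-- The Hasse diagram `W^𝔭`: the elements of `W` which have minimal length in their right coset
`W_𝔭 w`. -/
def hasse (b : (rootSystem H).Base) (i : b.support) : Set (W H) :=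
  {w | ∀ u ∈ Wp b i, length b w ≤ length b (u * w)}

/-- `w` is the longest element `w_0` of `W^𝔭`. -/
def IsLongest (b : (rootSystem H).Base) (i : b.support) (w : W H) : Prop :=
  w ∈ hasse b i ∧ ∀ v ∈ hasse b i, length b v ≤ length b w

/-- The inversion set `Δ(w) = w Δ⁻ ∩ Δ⁺`. -/
def invSet (b : (rootSystem H).Base) (w : W H) : Set H.root :=
  (rootSystem H).weylGroupToPerm w '' negRoots b ∩ posRoots b

/-- `𝔫_w = ⨁_{α ∈ Δ(w)} 𝔤_{-α}`. -/
def nilp (b : (rootSystem H).Base) (w : W H) : Submodule ℂ 𝔤 :=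
  ⨆ α ∈ invSet b w, (rootSpace H (-(α.1 : H → ℂ))).toSubmodule

/-- `𝔮_w ⊆ 𝔤_0`: the stabilizer of `𝔫_w` in `𝔤_0`. With `ℓ = dim 𝔫_w`, an element of `𝔤_0`
stabilizes the subspace `𝔫_w` of `𝔤_{-1}` if and only if it stabilizes the line `⋀^ℓ 𝔫_w` in
`⋀^ℓ 𝔤_{-1}`. -/
def stab (b : (rootSystem H).Base) (i : b.support) (w : W H) : Set 𝔤 :=
  {A | A ∈ gr b i 0 ∧ ∀ x ∈ nilp b w, ⁅A, x⁆ ∈ nilp b w}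

open Classical in
/-- The marking `J(w)`: the simple roots `α_j ≠ α_i` such that `𝔤_{-α_j}` is not contained in the
standard parabolic subalgebra `𝔮_w` of `𝔤_0`. As for every standard parabolic subalgebra, this is
the unique set `J` of simple roots of `𝔤_0` such that `𝔮_w` is the sum of the eigenspaces of
`∑_{j ∈ J} Z_j` on `𝔤_0` with eigenvalue `≥ 0`. -/
def marking (b : (rootSystem H).Base) (i : b.support) (w : W H) : Finset b.support :=
  {j | j ≠ i ∧ ¬ (rootSpace H (-(j.1.1 : H → ℂ)) : Set 𝔤) ⊆ stab b i w}

/-- `Z_w = ∑_{j ∈ J(w)} Z_j`. -/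
def Zw (b : (rootSystem H).Base) (i : b.support) (w : W H) : H :=
  ∑ j ∈ marking b i w, gradingElt b j

/-- The `(Z_i, Z_w)`-bigraded piece `𝔤_{k,l} = {A ∈ 𝔤_k | [Z_w, A] = l A}`. -/
def bigr (b : (rootSystem H).Base) (i : b.support) (w : W H) (k l : ℤ) : Submodule ℂ 𝔤 :=
  gr b i k ⊓ Module.End.eigenspace (LieAlgebra.ad ℂ 𝔤 (Zw b i w : 𝔤)) (l : ℂ)

/-- `a(w)`: the integer `a ≥ 0` such that `Δ(w) = {α ∈ Δ(𝔤_1) | α(Z_w) ≤ a}`. For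
`w ∈ W^𝔭 \ {1, w_0}` exactly one such `a` exists. (The values `α(Z_w)` are integers, so
that they are compared with `a` through their real parts.) -/
def depth (b : (rootSystem H).Base) (i : b.support) (w : W H) : ℕ :=
  sInf {a : ℕ | invSet b w =
    {α | α ∈ rootsIn H (gr b i 1 : Set 𝔤) ∧ ((α.1 : H → ℂ) (Zw b i w)).re ≤ a}}

/-- `Π_{1,a-1}`, with `a = a(w)`: the roots `ε ∈ Δ(𝔤_{1,a-1})` such that `ε + α` is not a root for
any `α ∈ Δ⁺(𝔤_{0,0})`. -/
def highest (b : (rootSystem H).Base) (i : b.support) (w : W H) : Set H.root :=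
  {ε | ε ∈ rootsIn H (bigr b i w 1 ((depth b i w : ℤ) - 1) : Set 𝔤) ∧
    ∀ α ∈ rootsIn H (bigr b i w 0 0 : Set 𝔤) ∩ posRoots b,
      (rootSystem H).root ε + (rootSystem H).root α ∉ Set.range (rootSystem H).root}

/-- `Δ(w,ε) = {ε} ⊔ {ν ∈ Δ(𝔤_{1,a}) | ν - ε ∈ Δ(𝔤_{0,1})}`, with `a = a(w)`. -/
def hook (b : (rootSystem H).Base) (i : b.support) (w : W H) (ε : H.root) : Set H.root :=
  {ε} ∪ {ν | ν ∈ rootsIn H (bigr b i w 1 (depth b i w) : Set 𝔤) ∧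
    (rootSystem H).root ν - (rootSystem H).root ε ∈
      (rootSystem H).root '' rootsIn H (bigr b i w 0 1 : Set 𝔤)}

end Cominuscule

end

/-! A set of roots of `Z_i`-degree 1 that is closed under subtracting positive roots of degree 0 is
an inversion set (`exists_inversions_eq`), and having no inversions of degree 0 is what puts an
element in the Hasse diagram (`mem_hasse_iff`). So only the closure of Δ(w) \ Δ(w,ε) is at stake.

Let g and f be the values of roots at `Z_i` and `Z_w`, so that Δ(w) = {g = 1, f ≤ a}
(`mem_inversions_iff_le_depth`). Take k in the difference and k = m + c with c positive of degree 0;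
then f m ≤ f k ≤ a, so m ∈ Δ(w). If m = ε, then f c is 0 or 1: the first contradicts the maximality
of ε, the second puts k in the hook. If m = ε + d is another element of the hook, then f m = a
forces f c = 0, so c + ε is not a root; by `root_add_mem_or_root_add_mem` c + d is one, and k = ε +
(c + d) lies in the hook.

The longer part is the description of Δ(w) by f. Put x = g ∘ w, with values in {-1, 0, 1}, let y be
the functional equal to max(x, 0) on simple roots, and z = y ∘ w⁻¹. Among roots of degree 1, z ≤ 0
holds exactly on the inversions. On simple roots of degree 0, z is 0 or 1, and 1 exactly on the
marked ones; the bound z ≤ 1 rests on `IsPos.exists_add_of_two_le`. Hence f and z differ by a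
multiple of g, and z ≤ 0 becomes an upper bound on f. -/

open Set

/-! ### Sums of roots and integral functionals on roots. -/

namespace RootPairing

variable {ι R M N : Type*} [CommRing R] [AddCommGroup M] [Module R M]
  [AddCommGroup N] [Module R N] {P : RootPairing ι R M N}

/-- Let `β`, `γ`, `β + γ` and `α + β + γ` be roots. Then one of `α + β` and `α + γ` is a root,
unless one of them is zero. -/
lemma root_add_mem_or_root_add_mem [Finite ι] [IsDomain R] [CharZero R] [P.IsCrystallographic]
    {i j k t s : ι}
    (ht : P.root t = P.root j + P.root k) (hs : P.root s = P.root i + P.root t)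
    (hij : P.root i + P.root j ≠ 0) (hik : P.root i + P.root k ≠ 0) :
    P.root i + P.root j ∈ range P.root ∨ P.root i + P.root k ∈ range P.root := by
  have : Fintype ι := Fintype.ofFinite ι
  by_contra! hcon
  obtain ⟨h₁, h₂⟩ := hcon
  let B := P.posRootForm ℤ
  have hB (a c : ι) : B.posForm (P.rootSpanMem ℤ a) (P.rootSpanMem ℤ c) ≤ 0 ↔
      P.pairingIn ℤ a c ≤ 0 := B.posForm_apply_root_root_le_zero_iff a c
  have hneg (a c : ι) (hne : P.root a + P.root c ≠ 0) (h : P.root a + P.root c ∉ range P.root) :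
      0 ≤ B.posForm (P.rootSpanMem ℤ a) (P.rootSpanMem ℤ c) := by
    have h0 : 0 ≤ P.pairingIn ℤ a c := by
      contrapose! h
      exact P.root_add_root_mem_of_pairingIn_neg h (by rwa [ne_eq, eq_neg_iff_add_eq_zero])
    let := P.indexNeg
    have h1 := (hB a (-c)).2 (by simpa using h0)
    have h2 : P.rootSpanMem ℤ (-c) = - P.rootSpanMem ℤ c := P.rootSpanMem_reflectionPerm_self ℤ c
    rw [h2] at h1
    simpa using h1
  have hle (a c : ι) (hne : P.root a - P.root c ≠ 0) (h : P.root a - P.root c ∉ range P.root) :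
      B.posForm (P.rootSpanMem ℤ a) (P.rootSpanMem ℤ c) ≤ 0 := by
    rw [hB]
    contrapose! h
    exact P.root_sub_root_mem_of_pairingIn_pos h (by rintro rfl; simp at hne)
  have e₁ : P.root s - P.root j = P.root i + P.root k := by rw [hs, ht]; abel
  have e₂ : P.root s - P.root k = P.root i + P.root j := by rw [hs, ht]; abel
  -- With α, β, γ the roots `i`, `j`, `k`: (s,β), (s,γ) ≤ 0 ≤ (α,β), (α,γ), while (s,β+γ) exceeds
  -- (α,β+γ) by the positive number (β+γ,β+γ).
  have a₁ := hle s j (by rwa [e₁]) (by rwa [e₁])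
  have a₂ := hle s k (by rwa [e₂]) (by rwa [e₂])
  have a₃ := hneg i j hij h₁
  have a₄ := hneg i k hik h₂
  have a₅ : 0 < B.posForm (P.rootSpanMem ℤ t) (P.rootSpanMem ℤ t) := B.rootLength_pos t
  have et : P.rootSpanMem ℤ t = P.rootSpanMem ℤ j + P.rootSpanMem ℤ k := Subtype.ext ht
  have es : P.rootSpanMem ℤ s = P.rootSpanMem ℤ i + P.rootSpanMem ℤ t := Subtype.ext hs
  have a₆ : B.posForm (P.rootSpanMem ℤ s) (P.rootSpanMem ℤ j) +
      B.posForm (P.rootSpanMem ℤ s) (P.rootSpanMem ℤ k) =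
      B.posForm (P.rootSpanMem ℤ i) (P.rootSpanMem ℤ j) +
      B.posForm (P.rootSpanMem ℤ i) (P.rootSpanMem ℤ k) +
      B.posForm (P.rootSpanMem ℤ t) (P.rootSpanMem ℤ t) := by
    rw [← map_add, ← et, es, map_add, LinearMap.add_apply, ← map_add, ← et]
  linarith

variable (P) in
/-- An integer-valued function on the roots that is the restriction of an additive map. -/
def IsRootFunctional (x : ι → ℤ) : Prop :=
  ∃ φ : M →+ R, ∀ k, φ (P.root k) = x k

namespace IsRootFunctional

variable {x y : ι → ℤ}

lemma sub (hx : P.IsRootFunctional x) (hy : P.IsRootFunctional y) :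
    P.IsRootFunctional fun k ↦ y k - x k := by
  obtain ⟨φ, hφ⟩ := hx
  obtain ⟨ψ, hψ⟩ := hy
  exact ⟨ψ - φ, fun k ↦ by simp [hφ, hψ]⟩

lemma neg (hx : P.IsRootFunctional x) : P.IsRootFunctional fun k ↦ - x k := by
  obtain ⟨φ, hφ⟩ := hx
  exact ⟨-φ, fun k ↦ by simp [hφ]⟩

lemma add_mul_const (hx : P.IsRootFunctional x) (hy : P.IsRootFunctional y) (t : ℤ) :
    P.IsRootFunctional fun k ↦ x k + t * y k := by
  obtain ⟨φ, hφ⟩ := hx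
  obtain ⟨ψ, hψ⟩ := hy
  exact ⟨φ + t • ψ, fun k ↦ by simp [hφ, hψ]⟩

lemma comp_weylGroup (hx : P.IsRootFunctional x) (w : P.weylGroup) :
    P.IsRootFunctional fun k ↦ x (P.weylGroupToPerm w k) := by
  obtain ⟨φ, hφ⟩ := hx
  exact ⟨φ.comp (DistribSMul.toAddMonoidHom M w), fun k ↦ by
    rw [← hφ, ← weylGroup_apply_root]; rfl⟩

variable [CharZero R]

lemma map_add (hx : P.IsRootFunctional x) {i j k : ι}
    (h : P.root k = P.root i + P.root j) : x k = x i + x j := by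
  obtain ⟨φ, hφ⟩ := hx
  have := congrArg φ h
  rw [_root_.map_add, hφ, hφ, hφ] at this
  exact_mod_cast this

lemma map_add_zsmul (hx : P.IsRootFunctional x) {i j k : ι} {z : ℤ}
    (h : P.root k = P.root i + z • P.root j) : x k = x i + z * x j := by
  obtain ⟨φ, hφ⟩ := hx
  have := congrArg φ h
  rw [_root_.map_add, map_zsmul, hφ, hφ, hφ, zsmul_eq_mul] at this
  exact_mod_cast this

lemma map_neg (hx : P.IsRootFunctional x) {i j : ι} (h : P.root j = - P.root i) : x j = - x i := by
  obtain ⟨φ, hφ⟩ := hx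
  have := congrArg φ h
  rw [_root_.map_neg, hφ, hφ] at this
  exact_mod_cast this

variable {b : P.Base}

lemma eq_of_eqOn_support [Finite ι] [IsDomain R] [P.IsCrystallographic]
    (hx : P.IsRootFunctional x) (hy : P.IsRootFunctional y)
    (h : ∀ j ∈ b.support, x j = y j) (k : ι) : x k = y k := by
  refine b.induction_add k (p := fun k ↦ x k = y k) (fun i hi ↦ ?_) h fun i j k hk hi hj ↦ ?_
  · have e : P.root (P.reflectionPerm i i) = - P.root i := by simp
    rw [hx.map_neg e, hy.map_neg e, hi]
  · rw [hx.map_add hk, hy.map_add hk, hi, h j hj]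

lemma nonneg_of_isPos [Finite ι] [IsDomain R] [P.IsCrystallographic]
    (hx : P.IsRootFunctional x) (h : ∀ j ∈ b.support, 0 ≤ x j) {k : ι} (hk : b.IsPos k) :
    0 ≤ x k := by
  refine hk.induction_on_add (p := fun k ↦ 0 ≤ x k) h fun i j k hk hi hj ↦ ?_
  rw [hx.map_add hk]
  exact add_nonneg hi (h j hj)

variable (b) in
lemma exists_of_support [P.IsRootSystem] (c : ι → ℤ) :
    ∃ x, P.IsRootFunctional x ∧ ∀ j ∈ b.support, x j = c j := by
  let φ : M →ₗ[R] R := b.toWeightBasis.constr ℤ fun j ↦ (c j : R)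
  have hφ (j : ι) (hj : j ∈ b.support) : φ (P.root j) = c j := by
    have := b.toWeightBasis.constr_basis ℤ (fun j ↦ (c j : R)) ⟨j, hj⟩
    rwa [b.toWeightBasis_apply] at this
  have hint (k : ι) : ∃ n : ℤ, φ (P.root k) = n := by
    obtain ⟨f, -, -, hf⟩ := b.exists_root_eq_sum_int k
    refine ⟨∑ j ∈ b.support, f j * c j, ?_⟩
    rw [hf, map_sum, Int.cast_sum]
    refine Finset.sum_congr rfl fun j hj ↦ ?_
    rw [map_zsmul, hφ j hj, zsmul_eq_mul, Int.cast_mul]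
  choose x hx using hint
  exact ⟨x, ⟨φ.toAddMonoidHom, hx⟩, fun j hj ↦ by
    have := (hx j).symm.trans (hφ j hj)
    exact_mod_cast this⟩

end IsRootFunctional

namespace Base

variable [CharZero R] {b : P.Base}

lemma isPos_neg_iff {i j : ι} (h : P.root j = - P.root i) : b.IsPos j ↔ ¬ b.IsPos i := by
  let := P.indexNeg
  obtain rfl : j = -i := P.root.injective (by simpa using h)
  exact IsPos.neg_iff_not b i

lemma IsPos.add_ne_zero {i j : ι} (hi : b.IsPos i) (hj : b.IsPos j) :
    P.root i + P.root j ≠ 0 := fun h ↦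
  (isPos_neg_iff (eq_neg_of_add_eq_zero_left h)).1 hi hj

variable [Finite ι] [IsDomain R] [P.IsCrystallographic]

lemma IsPos.mem_support_or_exists_add {k : ι} (hk : b.IsPos k) :
    k ∈ b.support ∨ ∃ i j, b.IsPos i ∧ j ∈ b.support ∧ P.root k = P.root i + P.root j := by
  refine (hk.induction_on_add (p := fun k ↦ b.IsPos k ∧ (k ∈ b.support ∨ ∃ i j, b.IsPos i ∧
    j ∈ b.support ∧ P.root k = P.root i + P.root j))
    (fun i hi ↦ ⟨isPos_of_mem_support hi, .inl hi⟩) fun i j k hk hi hj ↦ ?_).2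
  exact ⟨hi.1.add (isPos_of_mem_support hj) hk, .inr ⟨i, j, hi.1, hj, hk⟩⟩

/-! ### Splitting positive roots along a functional with values in {-1, 0, 1}. -/

section MinusculeFunctional

variable {x y : ι → ℤ} (hx : P.IsRootFunctional x) (hx1 : ∀ k, |x k| ≤ 1)
  (hy : P.IsRootFunctional y) (hxy : ∀ j ∈ b.support, y j = max (x j) 0)

include hx hx1 hy hxy

/-- Build the root up by simple roots. A simple root of value 0 leaves `y` unchanged and can be
absorbed into one of the two summands; one of value ±1 is itself a summand. -/
lemma IsPos.exists_add_of_eq_zero {k : ι} (hk : b.IsPos k) (hk0 : x k = 0) (hk1 : 1 ≤ y k) :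
    ∃ p n, b.IsPos p ∧ b.IsPos n ∧ P.root k = P.root p + P.root n ∧ x p = 1 ∧ x n = -1 := by
  refine (hk.induction_on_add (p := fun k ↦ b.IsPos k ∧ (x k = 0 → 1 ≤ y k →
    ∃ p n, b.IsPos p ∧ b.IsPos n ∧ P.root k = P.root p + P.root n ∧ x p = 1 ∧ x n = -1))
    (fun i hi ↦ ⟨isPos_of_mem_support hi, fun h0 h1 ↦ ?_⟩) fun i j k hk hi hj ↦ ?_).2 hk0 hk1
  · rw [hxy i hi, h0] at h1
    simp at h1
  have hj' := isPos_of_mem_support hj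
  refine ⟨hi.1.add hj' hk, fun h0 h1 ↦ ?_⟩
  have exk := hx.map_add hk
  have eyk := hy.map_add hk
  have hxj := abs_le.1 (hx1 j)
  obtain hj0 | hj0 | hj0 : x j = 0 ∨ x j = 1 ∨ x j = -1 := by lia
  · have := hxy j hj
    obtain ⟨p, n, hp, hn, e, hxp, hxn⟩ := hi.2 (by lia) (by simp_all)
    rcases root_add_mem_or_root_add_mem (i := j) e (by rw [hk, add_comm]) (hj'.add_ne_zero hp)
      (hj'.add_ne_zero hn) with ⟨q, hq⟩ | ⟨q, hq⟩
    · refine ⟨q, n, hj'.add hp hq, hn, by rw [hk, e, hq]; abel, ?_, hxn⟩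
      rw [hx.map_add hq]; lia
    · refine ⟨p, q, hp, hj'.add hn hq, by rw [hk, e, hq]; abel, hxp, ?_⟩
      rw [hx.map_add hq]; lia
  · exact ⟨j, i, hj', hi.1, by rw [hk, add_comm], hj0, by lia⟩
  · exact ⟨i, j, hi.1, hj', hk, by lia, hj0⟩

lemma IsPos.exists_add_add_of_eq_one {k : ι} (hk : b.IsPos k) (hk0 : x k = 1) (hk1 : 2 ≤ y k) :
    ∃ p q n d, b.IsPos p ∧ b.IsPos q ∧ b.IsPos n ∧ P.root d = P.root q + P.root n ∧
      P.root k = P.root p + P.root d ∧ x p = 1 ∧ x q = 1 ∧ x n = -1 := by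
  refine (hk.induction_on_add (p := fun k ↦ b.IsPos k ∧ (x k = 1 → 2 ≤ y k →
    ∃ p q n d, b.IsPos p ∧ b.IsPos q ∧ b.IsPos n ∧ P.root d = P.root q + P.root n ∧
      P.root k = P.root p + P.root d ∧ x p = 1 ∧ x q = 1 ∧ x n = -1))
    (fun i hi ↦ ⟨isPos_of_mem_support hi, fun h0 h1 ↦ ?_⟩) fun i j k hk hi hj ↦ ?_).2 hk0 hk1
  · rw [hxy i hi, h0] at h1
    simp at h1
  have hj' := isPos_of_mem_support hj
  refine ⟨hi.1.add hj' hk, fun h0 h1 ↦ ?_⟩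
  have exk := hx.map_add hk
  have eyk := hy.map_add hk
  have hxj := abs_le.1 (hx1 j)
  have hxi := abs_le.1 (hx1 i)
  have hyj := hxy j hj
  obtain hj0 | hj0 : x j = 0 ∨ x j = 1 := by lia
  · obtain ⟨p, q, n, d, hp, hq, hn, ed, ei, hxp, hxq, hxn⟩ := hi.2 (by lia) (by simp_all)
    have hd : b.IsPos d := hq.add hn ed
    rcases root_add_mem_or_root_add_mem (i := j) ei (by rw [hk, add_comm]) (hj'.add_ne_zero hp)
      (hj'.add_ne_zero hd) with ⟨r, hr⟩ | ⟨r, hr⟩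
    · refine ⟨r, q, n, d, hj'.add hp hr, hq, hn, ed, by rw [hk, ei, hr]; abel, ?_, hxq, hxn⟩
      rw [hx.map_add hr]; lia
    · rcases root_add_mem_or_root_add_mem (i := j) ed hr (hj'.add_ne_zero hq)
        (hj'.add_ne_zero hn) with ⟨s, hs⟩ | ⟨s, hs⟩
      · refine ⟨p, s, n, r, hp, hj'.add hq hs, hn, by rw [hr, hs, ed]; abel,
          by rw [hk, ei, hr]; abel, hxp, ?_, hxn⟩
        rw [hx.map_add hs]; lia
      · refine ⟨p, q, s, r, hp, hq, hj'.add hn hs, by rw [hr, hs, ed]; abel,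
          by rw [hk, ei, hr]; abel, hxp, hxq, ?_⟩
        rw [hx.map_add hs]; lia
  · obtain ⟨q, n, hq, hn, e, hxq, hxn⟩ := hi.1.exists_add_of_eq_zero hx hx1 hy hxy (by lia)
      (by rw [hj0] at hyj; simp at hyj; lia)
    exact ⟨j, q, n, i, hj', hq, hn, e, by rw [hk, add_comm], hj0, hxq, hxn⟩

/-- Split p further as p' + q + m with values 1, 1, -1 and regroup p' + q + m + n into two sums of
value 0. Groupings of value ±2 are not roots, which decides each alternative. -/
lemma IsPos.exists_add_of_two_le_of_eq_add {k p n : ι} (hp : b.IsPos p) (hn : b.IsPos n)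
    (hk : P.root k = P.root p + P.root n) (hxp : x p = 1) (hxn : x n = -1) (hyp : 2 ≤ y p) :
    ∃ i j, b.IsPos i ∧ b.IsPos j ∧ x i = 0 ∧ x j = 0 ∧ P.root k = P.root i + P.root j := by
  obtain ⟨p', q, m, d, hp', hq, hm, ed, ep, hxp', hxq, hxm⟩ :=
    hp.exists_add_add_of_eq_one hx hx1 hy hxy hxp hyp
  have hd : b.IsPos d := hq.add hm ed
  have not_mem {i j : ι} (h : 1 < |x i + x j|) : P.root i + P.root j ∉ range P.root := by
    rintro ⟨s, hs⟩
    have := hx1 s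
    rw [hx.map_add hs] at this
    lia
  rcases root_add_mem_or_root_add_mem (i := n) ep (by rw [hk, add_comm]) (hn.add_ne_zero hp')
    (hn.add_ne_zero hd) with ⟨r, hr⟩ | ⟨r, hr⟩
  · refine ⟨r, d, hn.add hp' hr, hd, ?_, ?_, by rw [hk, ep, hr]; abel⟩
    · rw [hx.map_add hr]; lia
    · rw [hx.map_add ed]; lia
  · obtain ⟨s, hs⟩ := (root_add_mem_or_root_add_mem (i := n) ed hr (hn.add_ne_zero hq)
      (hn.add_ne_zero hm)).resolve_right (not_mem (by simp [hxn, hxm]))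
    obtain ⟨t, ht⟩ := (root_add_mem_or_root_add_mem (i := p') ed ep (hp'.add_ne_zero hq)
      (hp'.add_ne_zero hm)).resolve_left (not_mem (by simp [hxp', hxq]))
    refine ⟨t, s, hp'.add hm ht, hn.add hq hs, ?_, ?_, by rw [hk, ep, ed, hs, ht]; abel⟩
    · rw [hx.map_add ht]; lia
    · rw [hx.map_add hs]; lia

/-- If all values of the functional `x` lie in `{-1, 0, 1}`, then every positive root in its kernel
which involves at least two simple roots of value `1`, counted with multiplicity, is the sum of two
positive roots in the kernel. -/
lemma IsPos.exists_add_of_two_le {k : ι} (hk : b.IsPos k) (hk0 : x k = 0) (hk1 : 2 ≤ y k) :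
    ∃ i j, b.IsPos i ∧ b.IsPos j ∧ x i = 0 ∧ x j = 0 ∧ P.root k = P.root i + P.root j := by
  obtain ⟨p, n, hp, hn, e, hxp, hxn⟩ :=
    hk.exists_add_of_eq_zero hx hx1 hy hxy hk0 (by lia)
  by_cases hyp : 2 ≤ y p
  · exact hp.exists_add_of_two_le_of_eq_add hx hx1 hy hxy hn e hxp hxn hyp
  · have := hy.map_add e
    -- Symmetric case: for -x the role of `y` is played by y - x, since max(-x, 0) = max(x, 0) - x;
    -- its value at n is y n + 1 ≥ 2.
    obtain ⟨i, j, hi, hj, hxi, hxj, e'⟩ := hn.exists_add_of_two_le_of_eq_add hx.neg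
      (by simpa using hx1) (hx.sub hy) (fun j hj ↦ by rw [hxy j hj]; lia) hp
      (by rw [e, add_comm]) (by lia) (by lia) (by lia)
    exact ⟨i, j, hi, hj, by lia, by lia, e'⟩

end MinusculeFunctional

end Base

end RootPairing

/-! ### Words in simple reflections, inversions and length. -/

namespace RootPairing

variable {ι R M N : Type*} [CommRing R] [AddCommGroup M] [Module R M]
  [AddCommGroup N] [Module R N] {P : RootPairing ι R M N}

lemma root_weylGroupToPerm_add (w : P.weylGroup) {i j k : ι}
    (h : P.root k = P.root i + P.root j) :
    P.root (P.weylGroupToPerm w k) =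
      P.root (P.weylGroupToPerm w i) + P.root (P.weylGroupToPerm w j) := by
  simp_rw [← weylGroup_apply_root, h, smul_add]

lemma root_weylGroupToPerm_neg (w : P.weylGroup) {i j : ι} (h : P.root j = - P.root i) :
    P.root (P.weylGroupToPerm w j) = - P.root (P.weylGroupToPerm w i) := by
  simp_rw [← weylGroup_apply_root, h, smul_neg]

lemma root_reflectionPerm_eq_neg (k : ι) : P.root (P.reflectionPerm k k) = - P.root k := by
  simp

lemma weylGroupToPerm_inv_apply_self (w : P.weylGroup) (k : ι) :
    P.weylGroupToPerm w⁻¹ (P.weylGroupToPerm w k) = k := by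
  rw [← Equiv.Perm.mul_apply, ← map_mul, inv_mul_cancel, map_one, Equiv.Perm.one_apply]

lemma weylGroupToPerm_apply_inv_self (w : P.weylGroup) (k : ι) :
    P.weylGroupToPerm w (P.weylGroupToPerm w⁻¹ k) = k := by
  rw [← Equiv.Perm.mul_apply, ← map_mul, mul_inv_cancel, map_one, Equiv.Perm.one_apply]

lemma weylGroupToPerm_mul_apply (v w : P.weylGroup) (k : ι) :
    P.weylGroupToPerm (v * w) k = P.weylGroupToPerm v (P.weylGroupToPerm w k) := by
  rw [map_mul, Equiv.Perm.mul_apply]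

lemma weylGroupToPerm_ofIdx (j k : ι) :
    P.weylGroupToPerm (weylGroup.ofIdx P j) k = P.reflectionPerm j k := rfl

lemma ofIdx_inv (j : ι) : (weylGroup.ofIdx P j)⁻¹ = weylGroup.ofIdx P j :=
  Subtype.ext (Equiv.reflection_inv P j)

lemma ofIdx_mul_self (j : ι) : weylGroup.ofIdx P j * weylGroup.ofIdx P j = 1 := by
  rw [mul_eq_one_iff_eq_inv, ofIdx_inv]

lemma ofIdx_reflectionPerm (j k : ι) :
    weylGroup.ofIdx P (P.reflectionPerm j k) =
      weylGroup.ofIdx P j * weylGroup.ofIdx P k * weylGroup.ofIdx P j := by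
  refine Subtype.ext (Equiv.weightHom_injective P ?_)
  ext m
  change P.reflection (P.reflectionPerm j k) m = P.reflection j (P.reflection k (P.reflection j m))
  rw [reflection_reflectionPerm]
  rfl

lemma ofIdx_reflectionPerm_self (j : ι) :
    weylGroup.ofIdx P (P.reflectionPerm j j) = weylGroup.ofIdx P j := by
  rw [ofIdx_reflectionPerm, ofIdx_mul_self, one_mul]

namespace Base

variable [CharZero R] [IsDomain R] [Finite ι] [P.IsCrystallographic] {b : P.Base}

variable (b) in
/-- The product of the simple reflections in a word. -/
noncomputable def wordProd (l : List b.support) : P.weylGroup :=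
  (l.map fun j ↦ weylGroup.ofIdx P (j : ι)).prod

omit [CharZero R] [IsDomain R] [Finite ι] [P.IsCrystallographic] in
@[simp] lemma wordProd_nil : b.wordProd [] = 1 := rfl

omit [CharZero R] [IsDomain R] [Finite ι] [P.IsCrystallographic] in
@[simp] lemma wordProd_cons (j : b.support) (l : List b.support) :
    b.wordProd (j :: l) = weylGroup.ofIdx P j * b.wordProd l := by
  simp [wordProd]

omit [CharZero R] [IsDomain R] [Finite ι] [P.IsCrystallographic] in
lemma wordProd_append (l l' : List b.support) :
    b.wordProd (l ++ l') = b.wordProd l * b.wordProd l' := by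
  simp [wordProd]

variable [P.IsReduced]

variable (b) in
lemma exists_wordProd_eq (w : P.weylGroup) : ∃ l, b.wordProd l = w := by
  obtain ⟨w, hw⟩ := w
  induction hw using weylGroup.induction with
  | mem k =>
    change ∃ l, b.wordProd l = weylGroup.ofIdx P k
    refine b.induction_reflect k (p := fun k ↦ ∃ l, b.wordProd l = weylGroup.ofIdx P k)
      (fun k h ↦ by rwa [ofIdx_reflectionPerm_self])
      (fun k hk ↦ ⟨[⟨k, hk⟩], by simp⟩) ?_
    rintro k j ⟨l, hl⟩ hj
    exact ⟨⟨j, hj⟩ :: (l ++ [⟨j, hj⟩]), by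
      rw [wordProd_cons, wordProd_append, hl, ofIdx_reflectionPerm, mul_assoc]; simp⟩
  | one => exact ⟨[], rfl⟩
  | mul v w hv hw ihv ihw =>
    obtain ⟨l, hl⟩ := ihv
    obtain ⟨l', hl'⟩ := ihw
    exact ⟨l ++ l', by rw [wordProd_append, hl, hl']; rfl⟩

/-- The strong exchange property. -/
lemma exists_wordProd_eq_ofIdx_mul (l : List b.support) {k : ι} (hk : b.IsPos k)
    (hk' : ¬ b.IsPos (P.weylGroupToPerm (b.wordProd l)⁻¹ k)) :
    ∃ l' : List b.support, l'.length + 1 = l.length ∧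
      b.wordProd l' = weylGroup.ofIdx P k * b.wordProd l := by
  induction l generalizing k with
  | nil =>
    rw [wordProd_nil, inv_one, map_one] at hk'
    exact absurd hk hk'
  | cons j l ih =>
    rcases eq_or_ne k j with rfl | hkj
    · exact ⟨l, by simp, by rw [wordProd_cons, ← mul_assoc, ofIdx_mul_self, one_mul]⟩
    -- A simple reflection permutes the positive roots other than its own, so the exchange can be
    -- made in the tail.
    have hpos := hk.reflectionPerm j.2 hkj
    obtain ⟨l', hl, e⟩ := ih hpos (by
      rwa [wordProd_cons, mul_inv_rev, ofIdx_inv, weylGroupToPerm_mul_apply,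
        weylGroupToPerm_ofIdx] at hk')
    refine ⟨j :: l', by simp [hl], ?_⟩
    rw [wordProd_cons, e, ofIdx_reflectionPerm, wordProd_cons]
    simp only [← mul_assoc, ofIdx_mul_self, one_mul]

variable (b) in
/-- The positive roots made negative by `w⁻¹`. -/
def inversions (w : P.weylGroup) : Set ι :=
  {k | b.IsPos k ∧ ¬ b.IsPos (P.weylGroupToPerm w⁻¹ k)}

omit [IsDomain R] [Finite ι] [P.IsCrystallographic] [P.IsReduced] in
lemma inversions_one : b.inversions 1 = ∅ := by
  ext k
  simp [inversions]

lemma inversions_ofIdx_mul {j : ι} (hj : j ∈ b.support) {w : P.weylGroup}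
    (hw : j ∉ b.inversions w) :
    b.inversions (weylGroup.ofIdx P j * w) =
      insert j (P.weylGroupToPerm (weylGroup.ofIdx P j) '' b.inversions w) := by
  have hj' := isPos_of_mem_support hj
  have hw' : b.IsPos (P.weylGroupToPerm w⁻¹ j) := by
    by_contra h
    exact hw ⟨hj', h⟩
  have hneg : P.root (P.reflectionPerm j j) = - P.root j :=
    root_reflectionPerm_eq_neg j
  ext k
  rw [mem_insert_iff]
  constructor
  · rintro ⟨hk, hk'⟩
    refine or_iff_not_imp_left.2 fun hkj ↦ ⟨P.reflectionPerm j k, ⟨hk.reflectionPerm hj hkj, ?_⟩, ?_⟩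
    · rwa [mul_inv_rev, ofIdx_inv, weylGroupToPerm_mul_apply, weylGroupToPerm_ofIdx] at hk'
    · rw [weylGroupToPerm_ofIdx, reflectionPerm_self]
  · rintro (rfl | ⟨k, ⟨hk, hk'⟩, rfl⟩)
    · refine ⟨hj', ?_⟩
      rw [mul_inv_rev, ofIdx_inv, weylGroupToPerm_mul_apply, weylGroupToPerm_ofIdx,
        isPos_neg_iff (root_weylGroupToPerm_neg w⁻¹ hneg)]
      simpa using hw'
    · have hkj : k ≠ j := by
        rintro rfl
        exact hk' hw'
      rw [weylGroupToPerm_ofIdx]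
      refine ⟨hk.reflectionPerm hj hkj, ?_⟩
      rwa [mul_inv_rev, ofIdx_inv, weylGroupToPerm_mul_apply, weylGroupToPerm_ofIdx,
        reflectionPerm_self]

/-- The length of a reduced word is the number of inversions. -/
lemma ncard_inversions_wordProd (l : List b.support)
    (hl : ∀ l' : List b.support, b.wordProd l' = b.wordProd l → l.length ≤ l'.length) :
    (b.inversions (b.wordProd l)).ncard = l.length := by
  induction l with
  | nil => simp [inversions_one]
  | cons j l ih =>
    have hl' : ∀ l' : List b.support, b.wordProd l' = b.wordProd l → l.length ≤ l'.length :=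
      fun l' h ↦ by simpa using hl (j :: l') (by rw [wordProd_cons, wordProd_cons, h])
    -- Otherwise exchange would give the whole product a word shorter than the tail.
    have hj : (j : ι) ∉ b.inversions (b.wordProd l) := by
      rintro ⟨h, h'⟩
      obtain ⟨l', h1, h2⟩ := exists_wordProd_eq_ofIdx_mul l h h'
      have := hl l' (by rw [h2, wordProd_cons])
      simp only [List.length_cons] at this
      lia
    rw [wordProd_cons, inversions_ofIdx_mul j.2 hj, ncard_insert_of_notMem, ncard_image_of_injective,
      ih hl', List.length_cons]
    · exact Equiv.injective _
    · rintro ⟨k, ⟨hk, -⟩, hkj⟩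
      have hneg : P.root k = - P.root j := by
        rw [weylGroupToPerm_ofIdx] at hkj
        rw [← root_reflectionPerm_eq_neg]
        nth_rw 2 [← hkj]
        rw [P.reflectionPerm_self]
      exact (isPos_neg_iff hneg).1 hk (isPos_of_mem_support j.2)

/-- The reflection changes the sign only of ±α_j, so only k = ±wα_j can change status, and -wα_j is
not positive. -/
lemma inversions_mul_ofIdx {j : ι} (hj : j ∈ b.support) {w : P.weylGroup}
    (hw : b.IsPos (P.weylGroupToPerm w j)) :
    b.inversions (w * weylGroup.ofIdx P j) = insert (P.weylGroupToPerm w j) (b.inversions w) := by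
  have hneg : P.root (P.reflectionPerm j j) = - P.root j :=
    root_reflectionPerm_eq_neg j
  have hj' := isPos_of_mem_support hj
  ext k
  simp only [inversions, mem_ofPred_eq, mem_insert_iff, mul_inv_rev, ofIdx_inv,
    weylGroupToPerm_mul_apply, weylGroupToPerm_ofIdx]
  obtain ⟨m, rfl⟩ := (P.weylGroupToPerm w).surjective k
  rw [weylGroupToPerm_inv_apply_self, (P.weylGroupToPerm w).injective.eq_iff]
  rcases eq_or_ne m j with rfl | hmj
  · simpa [isPos_neg_iff hneg, hj'] using hw
  by_cases hm : b.IsPos m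
  · simp [hm, hm.reflectionPerm hj hmj, hmj]
  simp only [hmj, hm, false_or, not_false_eq_true, and_true, and_iff_left_iff_imp]
  intro hk hm'
  have hmm : P.reflectionPerm j m ≠ j := by
    intro h
    have : P.root m = - P.root j := by
      rw [← hneg]
      nth_rw 2 [← h]
      rw [P.reflectionPerm_self]
    have h2 := root_weylGroupToPerm_neg w this
    exact (isPos_neg_iff h2).1 hk hw
  exact hm (by simpa using hm'.reflectionPerm hj hmm)

/-! ### Inversion sets in a grading with values in {-1, 0, 1}. -/

section Grading

variable {g : ι → ℤ} (hg : P.IsRootFunctional g) (hg1 : ∀ k, |g k| ≤ 1)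

include hg hg1

/-- In a grading with values in `{-1, 0, 1}`, the sets of roots of degree `1` which are closed under
subtraction of positive roots of degree `0` are inversion sets. -/
theorem exists_inversions_eq (hg0 : ∀ j ∈ b.support, 0 ≤ g j) (I : Set ι) (hI1 : ∀ k ∈ I, g k = 1)
    (hI : ∀ k ∈ I, ∀ i j, P.root k = P.root i + P.root j → g i = 1 → g j = 0 → b.IsPos j → i ∈ I) :
    ∃ w : P.weylGroup, b.inversions w = I := by
  induction hn : I.ncard generalizing I with
  | zero =>
    rw [ncard_eq_zero] at hn
    exact ⟨1, by rw [inversions_one, hn]⟩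
  | succ n ih =>
    have hne : I.Nonempty := by
      rw [← ncard_pos]; lia
    -- Maximal height ensures that removing k preserves closure: k is never obtained from another
    -- element of I by subtracting a positive root.
    obtain ⟨k, hk, hmax⟩ := I.toFinite.exists_maximalFor b.height I hne
    obtain ⟨w, hw⟩ := ih (I \ {k}) (fun m hm ↦ hI1 m hm.1) (fun m hm i j e hi hj hj' ↦ by
      refine ⟨hI m hm.1 i j e hi hj hj', ?_⟩
      rintro rfl
      have h1 := b.height_add e
      have h2 : 0 < b.height j := hj'
      have := hmax hm.1 (by lia)
      lia) (by rw [ncard_sdiff_singleton_of_mem hk, hn, Nat.add_sub_cancel])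
    have hpos (m : ι) (hm : g m = 1) : b.IsPos m := by
      by_contra h
      have hneg : P.root (P.reflectionPerm m m) = - P.root m :=
        root_reflectionPerm_eq_neg m
      have := hg.nonneg_of_isPos hg0 ((isPos_neg_iff hneg).2 h)
      rw [hg.map_neg hneg] at this
      lia
    have hk' : b.IsPos (P.weylGroupToPerm w⁻¹ k) := by
      by_contra h
      have : k ∈ b.inversions w := ⟨hpos k (hI1 k hk), h⟩
      rw [hw] at this
      exact this.2 rfl
    -- If w j is positive, closure makes w i an inversion of w, although i is positive. If w j is
    -- negative, -w j is an inversion of degree 0. Neither is possible, so w⁻¹k is indecomposable.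
    have key (i j : ι) (hi : b.IsPos i) (hj : b.IsPos j)
        (e : P.root (P.weylGroupToPerm w⁻¹ k) = P.root i + P.root j)
        (hgi : g (P.weylGroupToPerm w i) = 1) : False := by
      have e' := root_weylGroupToPerm_add w e
      rw [weylGroupToPerm_apply_inv_self] at e'
      have hgj : g (P.weylGroupToPerm w j) = 0 := by
        have := hg.map_add e'
        have := hI1 k hk
        lia
      by_cases hj' : b.IsPos (P.weylGroupToPerm w j)
      · have h1 := hI k hk _ _ e' hgi hgj hj'
        have h2 : P.weylGroupToPerm w i ∈ I \ {k} := by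
          refine ⟨h1, ?_⟩
          intro h
          rw [mem_singleton_iff] at h
          rw [h] at e'
          exact P.ne_zero _ (left_eq_add.1 e')
        rw [← hw] at h2
        exact h2.2 (by rwa [weylGroupToPerm_inv_apply_self])
      · have hneg : P.root (P.reflectionPerm (P.weylGroupToPerm w j) (P.weylGroupToPerm w j)) =
          - P.root (P.weylGroupToPerm w j) := root_reflectionPerm_eq_neg _
        have h2 : P.reflectionPerm (P.weylGroupToPerm w j) (P.weylGroupToPerm w j) ∈
            b.inversions w := by
          refine ⟨(isPos_neg_iff hneg).2 hj', ?_⟩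
          rw [isPos_neg_iff (root_weylGroupToPerm_neg w⁻¹ hneg), weylGroupToPerm_inv_apply_self]
          simpa using hj
        rw [hw] at h2
        have := hI1 _ h2.1
        rw [hg.map_neg hneg] at this
        lia
    have hsimple : P.weylGroupToPerm w⁻¹ k ∈ b.support := by
      refine hk'.mem_support_or_exists_add.resolve_right ?_
      rintro ⟨i, j, hi, hj, e⟩
      have hj := isPos_of_mem_support hj
      have e' := hg.map_add (root_weylGroupToPerm_add w e)
      rw [weylGroupToPerm_apply_inv_self, hI1 k hk] at e'
      have h1 := abs_le.1 (hg1 (P.weylGroupToPerm w i))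
      have h2 := abs_le.1 (hg1 (P.weylGroupToPerm w j))
      obtain h | h : g (P.weylGroupToPerm w i) = 1 ∨ g (P.weylGroupToPerm w j) = 1 := by lia
      · exact key i j hi hj e h
      · exact key j i hj hi (by rw [e, add_comm]) h
    refine ⟨w * weylGroup.ofIdx P (P.weylGroupToPerm w⁻¹ k), ?_⟩
    rw [inversions_mul_ofIdx hsimple, weylGroupToPerm_apply_inv_self, hw, insert_sdiff_singleton,
      insert_eq_of_mem hk]
    rw [weylGroupToPerm_apply_inv_self]
    exact hpos k (hI1 k hk)

omit [P.IsReduced] in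
/-- Let `w⁻¹` preserve the positivity of the roots of degree `0`, and let `f` be the functional
which is `1` on the simple roots of degree `0` along which one can leave the inversion set of `w`,
and `0` on the other simple roots. Then the inversions of `w` are singled out among the
roots of degree `1` by an upper bound on `f`. -/
theorem exists_inversions_iff_le [P.IsRootSystem] {i : ι}
    (hgi : g i = 1) (hgj : ∀ j ∈ b.support, j ≠ i → g j = 0) {w : P.weylGroup}
    (hw : ∀ k, b.IsPos k → g k = 0 → b.IsPos (P.weylGroupToPerm w⁻¹ k))
    {f : ι → ℤ} (hf : P.IsRootFunctional f) (hfi : f i = 0)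
    (hfj : ∀ j ∈ b.support, j ≠ i → f j = 0 ∨ f j = 1)
    (hfj' : ∀ j ∈ b.support, j ≠ i → (f j = 1 ↔ ∃ k m, g k = 1 ∧ P.root m = P.root k + P.root j ∧
      ¬ b.IsPos (P.weylGroupToPerm w⁻¹ k) ∧ b.IsPos (P.weylGroupToPerm w⁻¹ m))) :
    ∃ t : ℤ, ∀ k, g k = 1 → (¬ b.IsPos (P.weylGroupToPerm w⁻¹ k) ↔ f k ≤ t) := by
  set x : ι → ℤ := fun k ↦ g (P.weylGroupToPerm w k) with hxdef
  have hx : P.IsRootFunctional x := hg.comp_weylGroup w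
  have hx1 (k : ι) : |x k| ≤ 1 := hg1 _
  have hxw (k : ι) : x (P.weylGroupToPerm w⁻¹ k) = g k := by
    rw [hxdef]
    exact congrArg g (weylGroupToPerm_apply_inv_self w k)
  obtain ⟨y, hy, hxy⟩ := IsRootFunctional.exists_of_support b fun k ↦ max (x k) 0
  have hy0 {k : ι} (hk : b.IsPos k) : 0 ≤ y k :=
    hy.nonneg_of_isPos (fun j hj ↦ by rw [hxy j hj]; exact le_max_right _ _) hk
  have hy1 {k : ι} (hk : b.IsPos k) : x k ≤ y k := by
    have := (hx.sub hy).nonneg_of_isPos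
      (fun j hj ↦ by rw [hxy j hj, sub_nonneg]; exact le_max_left _ _) hk
    lia
  have hpos0 {k : ι} (hk : b.IsPos k) (hxk : x k = 0) : b.IsPos (P.weylGroupToPerm w k) := by
    by_contra h
    have hneg : P.root (P.reflectionPerm (P.weylGroupToPerm w k) (P.weylGroupToPerm w k)) =
      - P.root (P.weylGroupToPerm w k) := root_reflectionPerm_eq_neg _
    have h1 := hw _ ((isPos_neg_iff hneg).2 h) (by rw [hg.map_neg hneg]; simpa [hxdef] using hxk)
    rw [isPos_neg_iff (root_weylGroupToPerm_neg w⁻¹ hneg), weylGroupToPerm_inv_apply_self] at h1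
    exact h1 hk
  have hneg (k : ι) : ∃ k', P.root k' = - P.root k := ⟨P.reflectionPerm k k, by simp⟩
  set z : ι → ℤ := fun k ↦ y (P.weylGroupToPerm w⁻¹ k) with hzdef
  have hz : P.IsRootFunctional z := hy.comp_weylGroup w⁻¹
  have hzj (j : ι) (hj : j ∈ b.support) (hji : j ≠ i) : z j = f j := by
    have hj' := isPos_of_mem_support hj
    have hgj0 := hgj j hj hji
    have hpos := hw j hj' hgj0
    have hx0 : x (P.weylGroupToPerm w⁻¹ j) = 0 := by rw [hxw, hgj0]
    -- Otherwise w⁻¹α_j splits into two positive roots in the kernel of x; w keeps these positive,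
    -- contradicting that α_j is simple.
    have hle : z j ≤ 1 := by
      by_contra! h
      obtain ⟨p, q, hp, hq, hxp, hxq, e⟩ := hpos.exists_add_of_two_le hx hx1 hy hxy hx0 h
      have e' := root_weylGroupToPerm_add w e
      rw [weylGroupToPerm_apply_inv_self] at e'
      have h1 := b.height_add e'
      have h2 : 0 < b.height (P.weylGroupToPerm w p) := hpos0 hp hxp
      have h3 : 0 < b.height (P.weylGroupToPerm w q) := hpos0 hq hxq
      rw [height_one_of_mem_support hj] at h1
      lia
    have hge : 0 ≤ z j := hy0 hpos
    have hiff : 1 ≤ z j ↔ f j = 1 := by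
      rw [hfj' j hj hji]
      constructor
      · intro h
        obtain ⟨p, n, hp, hn, e, hxp, hxn⟩ := hpos.exists_add_of_eq_zero hx hx1 hy hxy hx0 h
        obtain ⟨n', hn'⟩ := hneg n
        have e' := root_weylGroupToPerm_add w e
        rw [weylGroupToPerm_apply_inv_self] at e'
        refine ⟨P.weylGroupToPerm w n', P.weylGroupToPerm w p, ?_, ?_, ?_, ?_⟩
        · rw [hg.map_neg (root_weylGroupToPerm_neg w hn')]
          simp only [hxdef] at hxn
          lia
        · rw [root_weylGroupToPerm_neg w hn', e']
          abel
        · rw [weylGroupToPerm_inv_apply_self, isPos_neg_iff hn']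
          simpa using hn
        · rwa [weylGroupToPerm_inv_apply_self]
      · rintro ⟨k, m, hgk, e, hk, hm⟩
        have h1 := hz.map_add e
        have h2 := hg.map_add e
        have h3 : x (P.weylGroupToPerm w⁻¹ m) ≤ z m := hy1 hm
        rw [hxw] at h3
        obtain ⟨k', hk'⟩ := hneg (P.weylGroupToPerm w⁻¹ k)
        have h4 := hy0 ((isPos_neg_iff hk').2 hk)
        rw [hy.map_neg hk'] at h4
        have h5 : z k = y (P.weylGroupToPerm w⁻¹ k) := rfl
        lia
    have := hfj j hj hji
    lia
  -- The coefficient of g is forced by f i = 0 and g i = 1; it also supplies the threshold -z i.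
  have hfz (k : ι) : f k = z k + -z i * g k := by
    refine hf.eq_of_eqOn_support (hz.add_mul_const hg (-z i)) (b := b) (fun j hj ↦ ?_) k
    rcases eq_or_ne j i with rfl | hji
    · rw [hfi, hgi]; lia
    · rw [hzj j hj hji, hgj j hj hji]; lia
  refine ⟨-z i, fun k hk ↦ ?_⟩
  rw [hfz, hk]
  constructor
  · intro h
    obtain ⟨k', hk'⟩ := hneg (P.weylGroupToPerm w⁻¹ k)
    have h4 := hy0 ((isPos_neg_iff hk').2 h)
    rw [hy.map_neg hk'] at h4
    have h5 : z k = y (P.weylGroupToPerm w⁻¹ k) := rfl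
    lia
  · intro h h'
    have h3 : x (P.weylGroupToPerm w⁻¹ k) ≤ z k := hy1 h'
    rw [hxw] at h3
    lia

end Grading

end Base

end RootPairing

/-! ### Brackets of root spaces and eigenvalues of the adjoint action. -/

open RootPairing RootPairing.Base LieModule

namespace LieAlgebra.IsKilling

variable {K L : Type*} [Field K] [CharZero K] [LieRing L] [LieAlgebra K L] [FiniteDimensional K L]
  {H : LieSubalgebra K L} [H.IsCartanSubalgebra] [IsTriangularizable K H L] [IsKilling K L]

/-- If `α`, `β` and `α + β` are weights with `α ≠ 0`, then the root spaces of `α` and `β` do not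
commute. -/
lemma exists_lie_ne_zero_of_rootSpace_add_ne_bot {α β : Weight K H L} (hα : α.IsNonZero)
    (h : rootSpace H (α + β : H → K) ≠ ⊥) :
    ∃ x ∈ rootSpace H α, ∃ y ∈ rootSpace H β, ⁅x, y⁆ ≠ 0 := by
  have hα' : (-α).IsNonZero := hα.neg
  obtain ⟨v, hv, hv0⟩ := (chainTop (-α) β).exists_ne_zero
  obtain ⟨h', e, f, isSl2, he, hf⟩ := exists_isSl2Triple_of_weight_isNonZero hα'
  obtain rfl := isSl2.h_eq_coroot hα' he hf
  -- The sl₂-triple is taken for -α, so its lowering operator f lies in the root space of α. From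
  -- the top v of the string, f^q v has weight β, and f^(q+1) v is nonzero because the string
  -- reaches α + β.
  have prim : isSl2.HasPrimitiveVectorWith v (chainLength (-α) β : K) :=
    have := lie_mem_genWeightSpace_of_mem_genWeightSpace he hv
    ⟨hv0, (chainLength_smul _ _ hv).symm, by rwa [genWeightSpace_add_chainTop _ _ hα'] at this⟩
  set q := chainTopCoeff (-α) β with hq
  have hfα : f ∈ rootSpace H α := by simpa using hf
  have hle : q + 1 ≤ chainLength (-α) β := by
    by_contra! hlt
    refine h ?_
    rw [← rootSpace_neg_nsmul_add_chainTop_of_lt (-α) β hα' hlt]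
    congr 1
    rw [coe_chainTop', ← hq, Weight.coe_neg]
    module
  refine ⟨f, hfα, ((toEnd K L L f) ^ q) v, ?_, ?_⟩
  · have := toEnd_pow_apply_mem hfα hv q
    convert this using 2
    rw [coe_chainTop', ← hq, Weight.coe_neg]
    module
  · rw [prim.lie_f_pow_toEnd_f]
    exact prim.pow_toEnd_f_ne_zero_of_eq_nat rfl hle

lemma rootSpace_subset_eigenspace_iff (α : Weight K H L) (Z : H) (c : K) :
    (rootSpace H α : Set L) ⊆ Module.End.eigenspace (ad K L (Z : L)) c ↔ α Z = c := by
  constructor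
  · intro h
    obtain ⟨v, hv, hv0⟩ := α.exists_ne_zero
    have h1 : ⁅(Z : L), v⁆ = c • v := Module.End.mem_eigenspace_iff.1 (h hv)
    have h2 : ⁅(Z : L), v⁆ = α Z • v := lie_eq_smul_of_mem_rootSpace hv Z
    exact smul_left_injective K hv0 (h2.symm.trans h1)
  · rintro rfl v hv
    exact Module.End.mem_eigenspace_iff.2 (lie_eq_smul_of_mem_rootSpace hv Z)

end LieAlgebra.IsKilling

/-! ### Degrees, the Hasse diagram, the marking and the depth. -/

namespace Cominuscule

variable {𝔤 : Type*} [LieRing 𝔤] [LieAlgebra ℂ 𝔤] [FiniteDimensional ℂ 𝔤] [LieAlgebra.IsSimple ℂ 𝔤]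
  {H : LieSubalgebra ℂ 𝔤} [H.IsCartanSubalgebra] {b : (rootSystem H).Base} {i : b.support}

lemma root_gradingElt (j : b.support) (k : H.root) :
    (k.1 : H → ℂ) (gradingElt b j) = b.toWeightBasis.coord j ((rootSystem H).root k) :=
  Module.apply_evalEquiv_symm_apply _ _ ((rootSystem H).root k) (b.toWeightBasis.coord j)

variable (b) in
open Classical in
lemma exists_isRootFunctional_sum_gradingElt (J : Finset b.support) :
    ∃ f : H.root → ℤ, (rootSystem H).IsRootFunctional f ∧
      (∀ k : H.root, (k.1 : H → ℂ) (∑ j ∈ J, gradingElt b j) = f k) ∧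
      ∀ j : b.support, f j = if j ∈ J then 1 else 0 := by
  obtain ⟨f, hf, hfb⟩ := IsRootFunctional.exists_of_support b
    fun k ↦ if ∃ h : k ∈ b.support, ⟨k, h⟩ ∈ J then 1 else 0
  have hfJ (j : b.support) : f j = if j ∈ J then 1 else 0 := by
    simp [hfb j j.2]
  refine ⟨f, hf, fun k ↦ ?_, hfJ⟩
  have hlin (k : H.root) : (k.1 : H → ℂ) (∑ j ∈ J, gradingElt b j) =
      (∑ j ∈ J, b.toWeightBasis.coord j) ((rootSystem H).root k) := by
    rw [LinearMap.sum_apply, ← Finset.sum_congr rfl fun j _ ↦ root_gradingElt j k]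
    exact map_sum ((rootSystem H).root k) _ _
  rw [hlin]
  have hbase (j : b.support) :
      (∑ j ∈ J, b.toWeightBasis.coord j) ((rootSystem H).root j) = f j := by
    simp_rw [hfJ, LinearMap.sum_apply, Module.Basis.coord_apply, b.toWeightBasis_repr_root,
      Finsupp.single_apply]
    simp
  refine b.induction_add k
    (p := fun k ↦ (∑ j ∈ J, b.toWeightBasis.coord j) ((rootSystem H).root k) = f k)
    (fun k hk ↦ ?_) (fun j hj ↦ hbase ⟨j, hj⟩) fun k j m e hk hj ↦ ?_
  · rw [hf.map_neg (root_reflectionPerm_eq_neg k), root_reflectionPerm_eq_neg, map_neg, hk,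
      Int.cast_neg]
  · rw [hf.map_add e, e, map_add, hk, hbase ⟨j, hj⟩, Int.cast_add]

lemma mem_rootsIn_gr_iff {g : H.root → ℤ} (hgZ : ∀ k : H.root, (k.1 : H → ℂ) (gradingElt b i) = g k)
    {k : H.root} {n : ℤ} : k ∈ rootsIn H (gr b i n : Set 𝔤) ↔ g k = n := by
  refine (rootSpace_subset_eigenspace_iff k.1 _ _).trans ?_
  rw [hgZ]
  exact Int.cast_inj

lemma mem_rootsIn_bigr_iff {g f : H.root → ℤ} {w : W H}
    (hgZ : ∀ k : H.root, (k.1 : H → ℂ) (gradingElt b i) = g k)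
    (hfZ : ∀ k : H.root, (k.1 : H → ℂ) (Zw b i w) = f k)
    {k : H.root} {n l : ℤ} : k ∈ rootsIn H (bigr b i w n l : Set 𝔤) ↔ g k = n ∧ f k = l := by
  rw [← mem_rootsIn_gr_iff hgZ]
  have h2 : (rootSpace H (k.1 : H → ℂ) : Set 𝔤) ⊆
      Module.End.eigenspace (ad ℂ 𝔤 (Zw b i w : 𝔤)) (l : ℂ) ↔ f k = l := by
    rw [rootSpace_subset_eigenspace_iff, hfZ]
    exact Int.cast_inj
  rw [← h2]
  exact subset_inter_iff

/-- Eigenspaces for distinct eigenvalues are independent, so no root space of another degree fits in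
𝔤_1 ⊕ 𝔤_0 ⊕ 𝔤_{-1}. -/
lemma IsCominuscule.abs_le_one (hi : IsCominuscule b i) {g : H.root → ℤ}
    (hgZ : ∀ k : H.root, (k.1 : H → ℂ) (gradingElt b i) = g k) (k : H.root) : |g k| ≤ 1 := by
  by_contra! hlt
  obtain ⟨v, hv, hv0⟩ := k.1.exists_ne_zero
  have hvk : v ∈ gr b i (g k) := (mem_rootsIn_gr_iff hgZ).2 rfl hv
  have hind := Module.End.eigenspaces_iSupIndep (ad ℂ 𝔤 (gradingElt b i : 𝔤)) (g k : ℂ)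
  refine hv0 (Submodule.disjoint_def.1 hind v hvk ?_)
  have hle (n : ℤ) (hn : n ≠ g k) : gr b i n ≤ ⨆ j, ⨆ (_ : j ≠ (g k : ℂ)),
      Module.End.eigenspace (ad ℂ 𝔤 (gradingElt b i : 𝔤)) j :=
    le_iSup₂_of_le (n : ℂ) (by exact_mod_cast hn) le_rfl
  have htop : v ∈ gr b i 1 ⊔ gr b i 0 ⊔ gr b i (-1) := by
    rw [show gr b i 1 ⊔ gr b i 0 ⊔ gr b i (-1) = ⊤ from hi]
    trivial
  refine sup_le (sup_le (hle 1 ?_) (hle 0 ?_)) (hle (-1) ?_) htop <;> rintro h <;>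
    simp [← h] at hlt

lemma invSet_eq_inversions (w : W H) : invSet b w = b.inversions w := by
  ext k
  have hneg (m : H.root) : m ∈ negRoots b ↔ ¬ b.IsPos m := by
    have := b.height_ne_zero m
    change b.height m < 0 ↔ ¬ 0 < b.height m
    lia
  constructor
  · rintro ⟨⟨m, hm, rfl⟩, hk⟩
    exact ⟨hk, by rwa [weylGroupToPerm_inv_apply_self, ← hneg]⟩
  · rintro ⟨hk, hk'⟩
    exact ⟨⟨_, (hneg _).2 hk', weylGroupToPerm_apply_inv_self w k⟩, hk⟩

lemma length_wordProd_le (l : List b.support) : length b (b.wordProd l) ≤ l.length :=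
  Nat.sInf_le ⟨l, rfl, rfl⟩

lemma exists_wordProd_length (w : W H) :
    ∃ l : List b.support, l.length = length b w ∧ b.wordProd l = w := by
  obtain ⟨l, hl⟩ := b.exists_wordProd_eq w
  exact Nat.sInf_mem (s := {n | ∃ l : List b.support, l.length = n ∧
    (l.map fun j ↦ refl (j : H.root)).prod = w}) ⟨l.length, l, rfl, hl⟩

lemma length_eq_ncard_inversions (w : W H) : length b w = (b.inversions w).ncard := by
  obtain ⟨l, hl, rfl⟩ := exists_wordProd_length (b := b) w
  rw [ncard_inversions_wordProd, hl]
  intro l' h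
  rw [hl, ← h]
  exact length_wordProd_le l'

section Grading

variable {g : H.root → ℤ} (hg : (rootSystem H).IsRootFunctional g)
  (hgZ : ∀ k : H.root, (k.1 : H → ℂ) (gradingElt b i) = g k)

include hg hgZ

lemma apply_of_mem_Wp {u : W H} (hu : u ∈ Wp b i) (k : H.root) :
    g ((rootSystem H).weylGroupToPerm u k) = g k := by
  induction hu using Subgroup.closure_induction generalizing k with
  | mem u hu =>
    obtain ⟨m, hm, rfl⟩ := hu
    have e : (rootSystem H).root ((rootSystem H).reflectionPerm m k) = (rootSystem H).root k +
        (-(rootSystem H).pairingIn ℤ k m) • (rootSystem H).root m := by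
      rw [root_reflectionPerm, neg_smul, reflection_apply_root' ℤ, sub_eq_add_neg]
    rw [mem_rootsIn_gr_iff hgZ] at hm
    have := hg.map_add_zsmul e
    rw [hm, mul_zero, add_zero] at this
    exact this
  | one => rw [map_one, Equiv.Perm.one_apply]
  | mul u v _ _ hu hv => rw [weylGroupToPerm_mul_apply, hu, hv]
  | inv u _ hu => rw [← hu, weylGroupToPerm_apply_inv_self]

/-- The elements of the Hasse diagram are those without inversions in `𝔤_0`. -/
lemma mem_hasse_iff (hgj : ∀ j ∈ b.support, 0 ≤ g j) {w : W H} :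
    w ∈ hasse b i ↔ ∀ k ∈ b.inversions w, g k ≠ 0 := by
  constructor
  · rintro hw k ⟨hk, hk'⟩ hgk
    obtain ⟨l, hl, rfl⟩ := exists_wordProd_length (b := b) w
    obtain ⟨l', hl', e⟩ := exists_wordProd_eq_ofIdx_mul l hk hk'
    have h1 := hw (refl k) (Subgroup.subset_closure ⟨k, (mem_rootsIn_gr_iff hgZ).2 hgk, rfl⟩)
    have h2 := length_wordProd_le l'
    rw [e] at h2
    change _ ≤ length b (weylGroup.ofIdx _ k * _) at h1
    lia
  · intro hw u hu
    -- u preserves degrees, so it carries the inversions of w, all of positive degree, injectively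
    -- to inversions of u * w.
    rw [length_eq_ncard_inversions, length_eq_ncard_inversions,
      ← ncard_image_of_injective _ ((rootSystem H).weylGroupToPerm u).injective]
    refine ncard_le_ncard ?_ (toFinite _)
    rintro _ ⟨k, hk, rfl⟩
    refine ⟨?_, ?_⟩
    · by_contra h
      have hneg := root_reflectionPerm_eq_neg (P := rootSystem H)
        ((rootSystem H).weylGroupToPerm u k)
      have h1 := hg.nonneg_of_isPos hgj ((isPos_neg_iff hneg).2 h)
      have h2 := hg.nonneg_of_isPos hgj hk.1
      rw [hg.map_neg hneg, apply_of_mem_Wp hg hgZ hu] at h1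
      have := hw k hk
      lia
    · rw [mul_inv_rev, weylGroupToPerm_mul_apply, weylGroupToPerm_inv_apply_self]
      exact hk.2

omit hg hgZ in
lemma rootSpace_neg_le_nilp {w : W H} {k : H.root} (hk : k ∈ b.inversions w) :
    (rootSpace H (-(k.1 : H → ℂ))).toSubmodule ≤ nilp b w := by
  rw [← invSet_eq_inversions] at hk
  exact le_iSup₂_of_le k hk le_rfl

omit hg hgZ in
lemma notMem_nilp {w : W H} {k : H.root} (hk : k ∉ b.inversions w) {v : 𝔤}
    (hv : v ∈ rootSpace H (-(k.1 : H → ℂ))) (hv0 : v ≠ 0) : v ∉ nilp b w := by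
  intro h
  have hind := LieSubmodule.iSupIndep_toSubmodule.2 (iSupIndep_genWeightSpace ℂ H 𝔤)
    (-(k.1 : H → ℂ))
  refine hv0 (Submodule.disjoint_def.1 hind v hv ?_)
  refine (iSup₂_le fun m hm ↦ ?_ : nilp b w ≤ _) h
  rw [invSet_eq_inversions] at hm
  refine le_iSup₂_of_le (-(m.1 : H → ℂ)) (fun e ↦ hk ?_) le_rfl
  have : m = k := Subtype.ext (DFunLike.coe_injective (neg_injective e))
  rwa [← this]

/-- The simple root `α_j` is marked if and only if adding it leads out of `Δ(w)` in `Δ(𝔤_1)`. -/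
lemma mem_marking_iff (hg1 : ∀ k, |g k| ≤ 1) (hg0 : ∀ j ∈ b.support, 0 ≤ g j)
    {w : W H} (hw : w ∈ hasse b i) (j : b.support) (hgj : g j = 0) :
    j ∈ marking b i w ↔ j ≠ i ∧ ∃ k m, g k = 1 ∧
      (rootSystem H).root m = (rootSystem H).root k + (rootSystem H).root j ∧
      ¬ b.IsPos ((rootSystem H).weylGroupToPerm w⁻¹ k) ∧
      b.IsPos ((rootSystem H).weylGroupToPerm w⁻¹ m) := by
  rw [mem_hasse_iff hg hgZ hg0] at hw
  have hj := isPos_of_mem_support j.2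
  simp only [marking, Finset.mem_filter_univ]
  refine and_congr_right fun _ ↦ ⟨fun h ↦ ?_, ?_⟩
  · by_contra! hcon
    refine h fun x hx ↦ ⟨?_, fun y hy ↦ ?_⟩
    · refine Module.End.mem_eigenspace_iff.2 ?_
      have := lie_eq_smul_of_mem_rootSpace hx (gradingElt b i)
      rw [Pi.neg_apply, hgZ, hgj] at this
      simpa using this
    · unfold nilp at hy
      rw [← iSup_subtype''] at hy
      refine Submodule.iSup_induction _ (motive := fun y ↦ ⁅x, y⁆ ∈ nilp b w) hy
        ?_ (by simp) fun y z hy hz ↦ by rw [lie_add]; exact add_mem hy hz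
      rintro ⟨k, hk⟩ y (hy : y ∈ rootSpace H (-(k.1 : H → ℂ)))
      rw [invSet_eq_inversions] at hk
      have hxy : ⁅x, y⁆ ∈ rootSpace H (-(j.1.1 : H → ℂ) + -(k.1 : H → ℂ)) :=
        lie_mem_genWeightSpace_of_mem_genWeightSpace hx hy
      by_cases hbot : rootSpace H (-(j.1.1 : H → ℂ) + -(k.1 : H → ℂ)) = ⊥
      · rw [hbot] at hxy
        rw [(LieSubmodule.mem_bot _).1 hxy]
        exact zero_mem _
      let χ : Weight ℂ H 𝔤 := ⟨_, hbot⟩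
      have hχ : (χ : H → ℂ) = -(j.1.1 : H → ℂ) + -(k.1 : H → ℂ) := rfl
      have hχ0 : χ.IsNonZero := by
        intro h0
        refine hk.1.add_ne_zero hj (LinearMap.ext fun z ↦ ?_)
        have := congrFun (hχ.symm.trans h0) z
        simp only [Pi.add_apply, Pi.neg_apply, Pi.zero_apply] at this
        simp only [rootSystem_root_apply, LinearMap.add_apply, Weight.toLinear_apply,
          LinearMap.zero_apply]
        linear_combination -this
      let m : H.root := ⟨-χ, by simpa using hχ0.neg⟩
      have hm : (rootSystem H).root m = (rootSystem H).root k + (rootSystem H).root j := by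
        refine LinearMap.ext fun z ↦ ?_
        simp only [rootSystem_root_apply, LinearMap.add_apply, Weight.toLinear_apply, m,
          Weight.coe_neg, hχ, Pi.neg_apply, Pi.add_apply]
        ring
      have hgk : g k = 1 := by
        have h1 := hg.nonneg_of_isPos hg0 hk.1
        have h2 := hw k hk
        have h3 := abs_le.1 (hg1 k)
        lia
      have hminv : m ∈ b.inversions w := ⟨hk.1.add hj hm, hcon k m hgk hm hk.2⟩
      refine rootSpace_neg_le_nilp hminv ?_
      have : -(m.1 : H → ℂ) = -(j.1.1 : H → ℂ) + -(k.1 : H → ℂ) := by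
        simp [m, hχ]
      rw [this]
      exact hxy
  · rintro ⟨k, m, hgk, e, hk, hm⟩ hsub
    have hadd : (-j.1.1 : Weight ℂ H 𝔤) + (-k.1 : Weight ℂ H 𝔤) = -(m.1 : H → ℂ) := by
      ext z
      have := congrArg (fun φ ↦ φ z) e
      simp only [rootSystem_root_apply, LinearMap.add_apply, Weight.toLinear_apply] at this
      simp only [Weight.coe_neg, Pi.neg_apply, Pi.add_apply, this]
      ring
    -- A nonzero bracket in the root space of -m leaves 𝔫_w, since m is not an inversion.
    obtain ⟨x, hx, y, hy, hxy⟩ := exists_lie_ne_zero_of_rootSpace_add_ne_bot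
      (α := -j.1.1) (β := -k.1) (H.isNonZero_coe_root j.1).neg (by
        rw [hadd]
        exact (-m.1).genWeightSpace_ne_bot)
    have hxy' := lie_mem_genWeightSpace_of_mem_genWeightSpace hx hy
    rw [hadd] at hxy'
    have hkpos : b.IsPos k := by
      by_contra h
      have hneg := root_reflectionPerm_eq_neg (P := rootSystem H) k
      have h1 := hg.nonneg_of_isPos hg0 ((isPos_neg_iff hneg).2 h)
      rw [hg.map_neg hneg] at h1
      lia
    refine notMem_nilp (b := b) (w := w) (k := m) (fun h ↦ h.2 hm) hxy' hxy ?_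
    exact (hsub hx).2 y (rootSpace_neg_le_nilp ⟨hkpos, hk⟩ hy)

end Grading

open Classical in
/-- The inversion set of a nontrivial element of the Hasse diagram is cut out by its depth. -/
lemma mem_inversions_iff_le_depth (hi : IsCominuscule b i) {w : W H} (hw : w ∈ hasse b i)
    {g f : H.root → ℤ} (hg : (rootSystem H).IsRootFunctional g)
    (hgZ : ∀ k : H.root, (k.1 : H → ℂ) (gradingElt b i) = g k)
    (hgi : g i = 1) (hgj : ∀ j ∈ b.support, j ≠ i → g j = 0)
    (hf : (rootSystem H).IsRootFunctional f)
    (hfZ : ∀ k : H.root, (k.1 : H → ℂ) (Zw b i w) = f k)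
    (hfJ : ∀ j : b.support, f j = if j ∈ marking b i w then 1 else 0)
    (hne : (b.inversions w).Nonempty) (k : H.root) :
    k ∈ b.inversions w ↔ g k = 1 ∧ f k ≤ depth b i w := by
  have hg1 := hi.abs_le_one hgZ
  have hg0 : ∀ j ∈ b.support, 0 ≤ g j := fun j hj ↦ by
    rcases eq_or_ne j i with rfl | h
    · lia
    · exact (hgj j hj h).ge
  have hf0 : ∀ j ∈ b.support, 0 ≤ f j := fun j hj ↦ by
    rw [hfJ ⟨j, hj⟩]; split_ifs <;> lia
  have hw' := (mem_hasse_iff hg hgZ hg0).1 hw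
  have hpos (k : H.root) (hk : g k = 1) : b.IsPos k := by
    by_contra h
    have hneg := root_reflectionPerm_eq_neg (P := rootSystem H) k
    have h1 := hg.nonneg_of_isPos hg0 ((isPos_neg_iff hneg).2 h)
    rw [hg.map_neg hneg] at h1
    lia
  have hinv1 (k : H.root) (hk : k ∈ b.inversions w) : g k = 1 := by
    have h1 := hg.nonneg_of_isPos hg0 hk.1
    have h2 := hw' k hk
    have h3 := abs_le.1 (hg1 k)
    lia
  obtain ⟨t, ht⟩ := exists_inversions_iff_le hg hg1 (i := i) hgi hgj (w := w)
    (fun k hk hgk ↦ by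
      by_contra h
      exact hw' k ⟨hk, h⟩ hgk) hf
    (by rw [hfJ, if_neg]; simp [marking])
    (fun j hj _ ↦ by rw [hfJ ⟨j, hj⟩]; split_ifs <;> simp)
    (fun j hj hji ↦ by
      have hji' : (⟨j, hj⟩ : b.support) ≠ i := fun h ↦ hji (congrArg Subtype.val h)
      have := mem_marking_iff hg hgZ hg1 hg0 hw ⟨j, hj⟩ (hgj j hj hji)
      rw [hfJ ⟨j, hj⟩]
      simp only [hji', ne_eq, not_false_eq_true, true_and] at this
      rw [← this]
      simp)
  have ht0 : 0 ≤ t := by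
    obtain ⟨k, hk⟩ := hne
    exact (hf.nonneg_of_isPos hf0 hk.1).trans ((ht k (hinv1 k hk)).1 hk.2)
  have hset (a : ℕ) : invSet b w = {α | α ∈ rootsIn H (gr b i 1 : Set 𝔤) ∧
      ((α.1 : H → ℂ) (Zw b i w)).re ≤ a} ↔
      ∀ k, k ∈ b.inversions w ↔ g k = 1 ∧ f k ≤ a := by
    rw [invSet_eq_inversions, Set.ext_iff]
    refine forall_congr' fun k ↦ iff_congr Iff.rfl ?_
    have h1 : ((k.1 : H → ℂ) (Zw b i w)).re ≤ a ↔ f k ≤ a := by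
      rw [hfZ, Complex.intCast_re]
      exact_mod_cast Iff.rfl
    exact and_congr (mem_rootsIn_gr_iff hgZ) h1
  have hmem : depth b i w ∈ {a : ℕ | invSet b w = {α | α ∈ rootsIn H (gr b i 1 : Set 𝔤) ∧
      ((α.1 : H → ℂ) (Zw b i w)).re ≤ a}} := by
    -- Nonnegativity of t provides a natural-number bound, so `depth` is an attained infimum and not
    -- the default 0.
    refine Nat.sInf_mem ⟨t.toNat, (hset _).2 fun k ↦ ?_⟩
    rw [Int.toNat_of_nonneg ht0]
    exact ⟨fun hk ↦ ⟨hinv1 k hk, (ht k (hinv1 k hk)).1 hk.2⟩,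
      fun ⟨h1, h2⟩ ↦ ⟨hpos k h1, (ht k h1).2 h2⟩⟩
  exact (hset _).1 hmem k

end Cominuscule

/-! ### Removing the hook. -/

theorem mainTheorem2 {𝔤 : Type*} [LieRing 𝔤] [LieAlgebra ℂ 𝔤] [FiniteDimensional ℂ 𝔤]
    [LieAlgebra.IsSimple ℂ 𝔤] {H : LieSubalgebra ℂ 𝔤} [H.IsCartanSubalgebra]
    (b : (LieAlgebra.IsKilling.rootSystem H).Base) (i : b.support)
    (hi : Cominuscule.IsCominuscule b i)
    (w : Cominuscule.W H) (hw : w ∈ Cominuscule.hasse b i)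
    (hw1 : w ≠ 1) (hw0 : ¬ Cominuscule.IsLongest b i w) :
    ∀ ε ∈ Cominuscule.highest b i w, ∃ wε ∈ Cominuscule.hasse b i,
      Cominuscule.invSet b wε = Cominuscule.invSet b w \ Cominuscule.hook b i w ε := by
  open Cominuscule in
  intro ε hε
  rcases (b.inversions w).eq_empty_or_nonempty with hempty | hne
  · exact ⟨w, hw, by rw [invSet_eq_inversions, hempty, Set.empty_sdiff]⟩
  obtain ⟨g, hg, hgZ, hgJ⟩ := exists_isRootFunctional_sum_gradingElt b {i}
  obtain ⟨f, hf, hfZ, hfJ⟩ := exists_isRootFunctional_sum_gradingElt b (marking b i w)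
  simp only [Finset.sum_singleton] at hgZ
  have hgi : g i = 1 := by rw [hgJ, if_pos (Finset.mem_singleton_self i)]
  have hgj : ∀ j ∈ b.support, j ≠ i → g j = 0 := fun j hj hji ↦ by
    rw [hgJ ⟨j, hj⟩, if_neg]
    rw [Finset.mem_singleton]
    exact fun h ↦ hji (congrArg Subtype.val h)
  have hg0 : ∀ j ∈ b.support, 0 ≤ g j := fun j hj ↦ by
    rw [hgJ ⟨j, hj⟩]; split_ifs <;> simp
  have hf0 : ∀ j ∈ b.support, 0 ≤ f j := fun j hj ↦ by
    rw [hfJ ⟨j, hj⟩]; split_ifs <;> lia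
  have hg1 := hi.abs_le_one hgZ
  have hinv := mem_inversions_iff_le_depth hi hw hg hgZ hgi hgj hf hfZ
    (fun j ↦ by rw [hfJ]) hne
  have hmem {k : H.root} {n l : ℤ} :
      k ∈ rootsIn H (bigr b i w n l : Set 𝔤) ↔ g k = n ∧ f k = l := mem_rootsIn_bigr_iff hgZ hfZ
  obtain ⟨hε1, hεmax⟩ := hε
  rw [hmem] at hε1
  have hhook (k : H.root) : k ∈ hook b i w ε ↔ k = ε ∨ (g k = 1 ∧ f k = depth b i w) ∧
      ∃ c, (g c = 0 ∧ f c = 1) ∧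
        (rootSystem H).root c = (rootSystem H).root k - (rootSystem H).root ε := by
    rw [hook, Set.mem_union, Set.mem_singleton_iff]
    refine or_congr Iff.rfl (and_congr hmem (exists_congr fun c ↦ and_congr hmem Iff.rfl))
  obtain ⟨v, hv⟩ := exists_inversions_eq hg hg1 hg0 (b.inversions w \ hook b i w ε)
    (fun k hk ↦ ((hinv k).1 hk.1).1) fun k ⟨hk, hkε⟩ m c e hgm hgc hc ↦ by
      rw [hinv] at hk
      rw [hhook] at hkε
      push Not at hkε
      have hfe := hf.map_add e
      have hfc := hf.nonneg_of_isPos hf0 hc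
      refine ⟨(hinv m).2 ⟨hgm, by lia⟩, fun hm ↦ ?_⟩
      rw [hhook] at hm
      rcases hm with rfl | ⟨⟨-, hfm⟩, d, ⟨hgd, hfd⟩, ed⟩
      · obtain hc0 | hc1 : f c = 0 ∨ f c = 1 := by lia
        · exact hεmax c ⟨hmem.2 ⟨hgc, hc0⟩, hc⟩ ⟨k, e⟩
        · exact hkε.2 ⟨hk.1, by lia⟩ c ⟨hgc, hc1⟩ (by rw [e]; abel)
      · have hfc0 : f c = 0 := by lia
        have hcε : (rootSystem H).root c + (rootSystem H).root ε ∉ Set.range (rootSystem H).root := by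
          rw [add_comm]
          exact hεmax c ⟨hmem.2 ⟨hgc, hfc0⟩, hc⟩
        have ne1 : (rootSystem H).root c + (rootSystem H).root ε ≠ 0 := fun h ↦ by
          have := hg.map_neg (eq_neg_of_add_eq_zero_left h)
          lia
        have ne2 : (rootSystem H).root c + (rootSystem H).root d ≠ 0 := fun h ↦ by
          have := hf.map_neg (eq_neg_of_add_eq_zero_left h)
          lia
        -- Here k = c + (ε + d); since c + ε is not a root, s = c + d is one, and it has bidegree
        -- (0, 1).
        obtain ⟨s, hs⟩ := (root_add_mem_or_root_add_mem (i := c) (j := ε) (k := d) (t := m)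
          (by rw [ed]; abel) (by rw [e, add_comm]) ne1 ne2).resolve_left hcε
        have hgs := hg.map_add hs
        have hfs := hf.map_add hs
        exact hkε.2 ⟨hk.1, by lia⟩ s ⟨by lia, by lia⟩ (by rw [hs, ed, e]; abel)
  refine ⟨v, (mem_hasse_iff hg hgZ hg0).2 fun k hk h0 ↦ ?_, ?_⟩
  · rw [hv, Set.mem_sdiff, hinv] at hk
    lia
  · rw [invSet_eq_inversions, invSet_eq_inversions, hv]
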